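/- Let $X$ be a nonempty compact Hausdorff space and let $f : X \to X$ be continuous. Let $\omega^* = \beta\omega \setminus \omega$ be the space of nonprincipal ultrafilters on $\omega$, and let $\sigma : \omega^* \to \omega^*$ be the shift map, which sends an ultrafilter $p$ to the ultrafilter generated by $\{A+1 : A \in p\}$. Let $\mathfrak{p}$ be the pseudo-intersection number, i.e. the least cardinality of a family $\mathcal{F}$ of subsets of $\omega$ such that every finite subfamily of $\mathcal{F}$ has infinite intersection but there is no infinite $A \subseteq \omega$ with $A \setminus F$ finite for all $F \in \mathcal{F}$. Suppose that the weight of $X$ (the least cardinality of a base for its topology) is less than $\mathfrak{p}$. Then $(X,f)$ is a quotient of $(\omega^*,\sigma)$, meaning that there is a continuous surjection $Q : \omega^* \to X$ with $Q \circ \sigma = f \circ Q$, if and only if $f$ is weakly incompressible, meaning that $f(\overline{U}) \not\subseteq U$ for every open $U \subseteq X$ with $\emptyset \neq U \neq X$. -/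

import Mathlib

open Set
open scoped Cardinal

universe u v

/-- The weight of a topological space: the least cardinality of a base for its topology. -/
noncomputable def topologicalWeight (X : Type u) [TopologicalSpace X] : Cardinal.{u} :=
  sInf {κ | ∃ B : Set (Set X), TopologicalSpace.IsTopologicalBasis B ∧ #B = κ}

/-- A family of subsets of `ℕ` has the strong finite intersection property if every finite
subfamily has infinite intersection. -/
def HasSFIP (𝓕 : Set (Set ℕ)) : Prop :=
  ∀ 𝓖 ⊆ 𝓕, 𝓖.Finite → (⋂₀ 𝓖).Infinite

/-- `A` is an infinite pseudo-intersection of `𝓕`: `A` is infinite and `A ⊆* F` (that is,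
`A \ F` is finite) for every `F ∈ 𝓕`. -/
def IsInfinitePseudoIntersection (A : Set ℕ) (𝓕 : Set (Set ℕ)) : Prop :=
  A.Infinite ∧ ∀ F ∈ 𝓕, (A \ F).Finite

/-- The pseudo-intersection number `𝔭`: the least cardinality of a family of subsets of `ℕ` that
has the strong finite intersection property but no infinite pseudo-intersection. -/
noncomputable def pseudoIntersectionNumber : Cardinal.{0} :=
  sInf {κ | ∃ 𝓕 : Set (Set ℕ), HasSFIP 𝓕 ∧
    (¬ ∃ A, IsInfinitePseudoIntersection A 𝓕) ∧ #𝓕 = κ}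

/-- The infimum defining `𝔭` is over a nonempty set: any nonprincipal ultrafilter is a family with
the strong finite intersection property and no infinite pseudo-intersection. -/
theorem pseudoIntersectionNumber_set_nonempty :
    {κ : Cardinal.{0} | ∃ 𝓕 : Set (Set ℕ), HasSFIP 𝓕 ∧
      (¬ ∃ A, IsInfinitePseudoIntersection A 𝓕) ∧ #𝓕 = κ}.Nonempty := by
  have key : ∀ s ∈ Filter.hyperfilter ℕ, s.Infinite :=
    fun s hs hfin => Filter.notMem_hyperfilter_of_finite hfin hs
  refine ⟨_, {s | s ∈ Filter.hyperfilter ℕ}, ?_, ?_, rfl⟩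
  · intro 𝓖 h𝓖 hfin
    exact key _ ((Filter.sInter_mem hfin).2 fun s hs => h𝓖 hs)
  · rintro ⟨A, hA, hAF⟩
    obtain ⟨g, hg⟩ : ∃ g : ℕ → ℕ, StrictMono g ∧ range g = A :=
      ⟨Nat.nth (· ∈ A), Nat.nth_strictMono hA, Nat.range_nth_of_infinite hA⟩
    have hsub : ∀ (h : ℕ → ℕ), StrictMono h → (∀ n, h n ∈ A) →
        ∀ T : Set ℕ, (∀ n, h n ∉ T) → T ∉ Filter.hyperfilter ℕ := by
      intro h hm hA' T hT hTm
      refine (Set.infinite_range_of_injective hm.injective).mono ?_ (hAF T hTm)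
      rintro _ ⟨n, rfl⟩
      exact ⟨hA' n, hT n⟩
    have hmem : ∀ n, g n ∈ A := fun n => hg.2 ▸ mem_range_self n
    have h1 := hsub (fun n => g (2 * n)) (hg.1.comp fun a b h => by show 2 * a < 2 * b; omega)
      (fun n => hmem _) (range fun n => g (2 * n))ᶜ (fun n => by simp)
    have h2 := hsub (fun n => g (2 * n + 1))
      (hg.1.comp fun a b h => by show 2 * a + 1 < 2 * b + 1; omega)
      (fun n => hmem _) (range fun n => g (2 * n)) (by
        rintro n ⟨m, hm⟩
        have := hg.1.injective hm
        omega)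
    exact h1 (Ultrafilter.compl_mem_iff_notMem.2 h2)

/-- `ω* = βω \ ω`, the space of nonprincipal ultrafilters on `ℕ`, with the topology inherited from
the Stone space `Ultrafilter ℕ = βω`. -/
abbrev OmegaStar : Type := {p : Ultrafilter ℕ // ∀ n : ℕ, p ≠ pure n}

theorem map_succ_nonprincipal (p : OmegaStar) (n : ℕ) :
    Ultrafilter.map (fun k : ℕ => k + 1) p.1 ≠ pure n := by
  intro h
  have h1 : ({n} : Set ℕ) ∈ Ultrafilter.map (fun k : ℕ => k + 1) p.1 := by
    rw [h]; exact rfl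
  rw [Ultrafilter.mem_map] at h1
  have hfin : ((fun k : ℕ => k + 1) ⁻¹' {n}).Finite :=
    (Set.finite_singleton n).preimage (fun a _ b _ hab => by simpa using hab)
  obtain ⟨x, -, hx⟩ := Ultrafilter.eq_pure_of_finite_mem hfin h1
  exact p.2 x hx

/-- The shift map `σ : ω* → ω*`; `σ p` is the ultrafilter generated by `{A + 1 | A ∈ p}`, i.e. the
pushforward of `p` under `k ↦ k + 1`. -/
def shiftMap (p : OmegaStar) : OmegaStar :=
  ⟨Ultrafilter.map (fun k : ℕ => k + 1) p.1, map_succ_nonprincipal p⟩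

/-- `(X, f)` is a quotient of `(Y, g)`: there is a continuous surjection `Q : Y → X` with
`Q ∘ g = f ∘ Q`. -/
def IsQuotientSystem {X : Type u} [TopologicalSpace X] (f : X → X)
    {Y : Type v} [TopologicalSpace Y] (g : Y → Y) : Prop :=
  ∃ Q : Y → X, Continuous Q ∧ Function.Surjective Q ∧ Q ∘ g = f ∘ Q

/-- `f` is weakly incompressible: no open `U` with `∅ ≠ U ≠ X` satisfies `f(closure U) ⊆ U`. -/
def WeaklyIncompressible {X : Type u} [TopologicalSpace X] (f : X → X) : Prop :=
  ∀ U : Set X, IsOpen U → U.Nonempty → U ≠ univ → ¬ f '' closure U ⊆ U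

/-! ### The space `ω*`, and why quotients of the shift are weakly incompressible. -/

section OmegaStar

open Filter Topology

/-! Necessity: if `f` maps the closure of `U` into `U`, a set `A ⊆ ℕ` separates `Q⁻¹(f(closure U))`
from the complement of `Q⁻¹(U)`. Then `A ⊆* A - 1`, so `A`, being infinite, is cofinite, and
surjectivity of `Q` gives `U = X`.

Sufficiency: fix a base `b` indexed by fewer than `𝔭` elements. For each finite `F` of indices, weak
incompressibility yields an `F`-approximate loop of `f` at a fixed point `a`, visiting every
nonempty `b i` with `i ∈ F` (`WeaklyIncompressible.transGen_chainStep`, `exists_isLoopCode`). As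
seen by `F`, a loop is a word over a countable alphabet (`exists_countable_traces`), so `𝔭` provides
one sequence of words that eventually codes loops for every `F` (`exists_seq_eventually_mem`).
Concatenating the words gives sets `A i ⊆ ℕ`, a virtual pseudo-orbit: the points realizing it may
depend on `F`. The quotient map sends `p` to the unique point in all `closure (b i)` with `A i ∈ p`.
-/

instance : CompactSpace OmegaStar := by
  refine isCompact_iff_compactSpace.1 (IsClosed.isCompact ?_)
  have : {p : Ultrafilter ℕ | ∀ n : ℕ, p ≠ pure n} = ⋂ n : ℕ, {p | ({n} : Set ℕ) ∈ p}ᶜ := by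
    ext p
    simp only [mem_ofPred_eq, mem_iInter, mem_compl_iff]
    refine forall_congr' fun n => not_congr ⟨fun h => by rw [h]; exact rfl, fun h => ?_⟩
    obtain ⟨x, hx, hp⟩ := Ultrafilter.eq_pure_of_finite_mem (finite_singleton n) h
    rwa [mem_singleton_iff.1 hx] at hp
  change IsClosed {p : Ultrafilter ℕ | ∀ n : ℕ, p ≠ pure n}
  rw [this]
  exact isClosed_iInter fun n => (ultrafilter_isOpen_basic _).isClosed_compl

theorem OmegaStar.infinite_of_mem (p : OmegaStar) {A : Set ℕ} (hA : A ∈ p.1) : A.Infinite := by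
  intro hfin
  obtain ⟨x, -, hx⟩ := Ultrafilter.eq_pure_of_finite_mem hfin hA
  exact p.2 x hx

theorem OmegaStar.mem_of_eventually (p : OmegaStar) {A : Set ℕ} (hA : ∀ᶠ n in atTop, n ∈ A) :
    A ∈ p.1 := by
  by_contra h
  refine p.infinite_of_mem (Ultrafilter.compl_mem_iff_notMem.2 h) ?_
  rwa [← Nat.cofinite_eq_atTop] at hA

theorem OmegaStar.exists_mem_of_infinite {A : Set ℕ} (hA : A.Infinite) :
    ∃ p : OmegaStar, A ∈ p.1 := by
  have : NeBot (cofinite ⊓ 𝓟 A) := cofinite_inf_principal_neBot_iff.2 hA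
  have hle := Ultrafilter.of_le (cofinite ⊓ 𝓟 A)
  refine ⟨⟨Ultrafilter.of (cofinite ⊓ 𝓟 A), fun n hn => ?_⟩,
    hle (mem_inf_of_right (mem_principal_self A))⟩
  have h : ({n}ᶜ : Set ℕ) ∈ Ultrafilter.of (cofinite ⊓ 𝓟 A) :=
    hle (mem_inf_of_left (finite_singleton n).compl_mem_cofinite)
  rw [hn] at h
  exact h rfl

theorem OmegaStar.isOpen_basic (A : Set ℕ) : IsOpen {p : OmegaStar | A ∈ p.1} :=
  (ultrafilter_isOpen_basic A).preimage continuous_subtype_val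

theorem OmegaStar.exists_basic_subset {V : Set OmegaStar} (hV : IsOpen V) {p : OmegaStar}
    (hp : p ∈ V) : ∃ A ∈ p.1, {q : OmegaStar | A ∈ q.1} ⊆ V := by
  obtain ⟨W, hW, rfl⟩ := isOpen_induced_iff.1 hV
  obtain ⟨_, ⟨A, rfl⟩, hpA, hAW⟩ := ultrafilterBasis_is_basis.exists_subset_of_mem_open hp hW
  exact ⟨A, hpA, fun q hq => hAW hq⟩

theorem OmegaStar.exists_basic_between {K V : Set OmegaStar} (hK : IsCompact K) (hV : IsOpen V)
    (hKV : K ⊆ V) : ∃ A : Set ℕ, K ⊆ {p | A ∈ p.1} ∧ {p : OmegaStar | A ∈ p.1} ⊆ V := by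
  choose! A hA hAV using fun p (hp : p ∈ K) => exists_basic_subset hV (hKV hp)
  obtain ⟨t, hKt⟩ := hK.elim_nhds_subcover' (fun p _ => {q : OmegaStar | A p ∈ q.1})
    fun p hp => (isOpen_basic _).mem_nhds (hA p hp)
  refine ⟨⋃ p ∈ t, A p, fun q hq => ?_, fun q hq => ?_⟩
  · obtain ⟨p, hp, hqp⟩ := mem_iUnion₂.1 (hKt hq)
    exact mem_of_superset hqp (subset_biUnion_of_mem (u := fun p : K => A p) hp)
  · obtain ⟨p, hp, hqp⟩ := (Ultrafilter.finite_biUnion_mem_iff t.finite_toSet).1 hq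
    exact hAV p p.2 hqp

theorem weaklyIncompressible_of_isQuotientSystem {X : Type u} [TopologicalSpace X]
    [CompactSpace X] [T2Space X] {f : X → X} (hf : Continuous f)
    (h : IsQuotientSystem f shiftMap) : WeaklyIncompressible f := by
  obtain ⟨Q, hQ, hsurj, hcomm⟩ := h
  intro U hU hne huniv hfU
  have hclosed : IsClosed (f '' closure U) := (isClosed_closure.isCompact.image hf).isClosed
  obtain ⟨A, hKA, hAV⟩ := OmegaStar.exists_basic_between (hclosed.preimage hQ).isCompact
    (hU.preimage hQ) (preimage_mono hfU)
  -- An ultrafilter `p` on the difference would have `Q (σ p) = f (Q p)` in `f(closure U)`, forcing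
  -- `A ∈ σ p`.
  have hstep : (A \ {n | n + 1 ∈ A}).Finite := by
    by_contra hinf
    obtain ⟨p, hp⟩ := OmegaStar.exists_mem_of_infinite hinf
    have hpA : A ∈ p.1 := mem_of_superset hp sdiff_subset
    have hσ : shiftMap p ∈ Q ⁻¹' (f '' closure U) :=
      ⟨Q p, subset_closure (hAV hpA), (congrFun hcomm p).symm⟩
    have h1 : {n | n + 1 ∈ A} ∈ p.1 := hKA hσ
    obtain ⟨n, hn, hn'⟩ := p.1.nonempty_of_mem (inter_mem hp h1)
    exact hn.2 hn'
  obtain ⟨u, hu⟩ := hne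
  obtain ⟨p, hp⟩ := hsurj (f u)
  have hpA : A ∈ p.1 := hKA ⟨u, subset_closure hu, hp.symm⟩
  obtain ⟨N, hN⟩ := hstep.bddAbove
  obtain ⟨m, hmA, hm⟩ := (p.infinite_of_mem hpA).exists_gt N
  have htail : ∀ n ≥ m, n ∈ A := by
    intro n hn
    induction n, hn using Nat.le_induction with
    | base => exact hmA
    | succ n hn ih =>
      by_contra hnA
      have := hN ⟨ih, hnA⟩
      omega
  refine huniv (eq_univ_of_forall fun y => ?_)
  obtain ⟨q, rfl⟩ := hsurj y
  exact hAV (q.mem_of_eventually (eventually_atTop.2 ⟨m, htail⟩))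

end OmegaStar

/-! ### Consequences of having fewer than `𝔭` indices. -/

section Cardinals

theorem aleph0_le_pseudoIntersectionNumber : ℵ₀ ≤ pseudoIntersectionNumber := by
  refine le_csInf pseudoIntersectionNumber_set_nonempty ?_
  rintro _ ⟨𝓕, hF, hno, rfl⟩
  by_contra hlt
  have hfin : 𝓕.Finite := Cardinal.lt_aleph0_iff_set_finite.1 (not_le.1 hlt)
  exact hno ⟨⋂₀ 𝓕, hF 𝓕 subset_rfl hfin, fun F hFm => by
    rw [sdiff_eq_empty.2 (sInter_subset_of_mem hFm)]; exact finite_empty⟩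

theorem pseudoIntersectionNumber_le_continuum : pseudoIntersectionNumber ≤ Cardinal.continuum := by
  obtain ⟨κ, h⟩ := pseudoIntersectionNumber_set_nonempty
  refine (csInf_le' h).trans ?_
  obtain ⟨𝓕, -, -, rfl⟩ := h
  exact (Cardinal.mk_set_le 𝓕).trans (by simp)

theorem exists_pseudoIntersection {𝓕 : Set (Set ℕ)} (hF : HasSFIP 𝓕)
    (hcard : #𝓕 < pseudoIntersectionNumber) : ∃ A, IsInfinitePseudoIntersection A 𝓕 := by
  by_contra hno
  exact hcard.not_ge (csInf_le' ⟨𝓕, hF, hno, rfl⟩)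

/-- A directed family of fewer than `𝔭` infinite subsets of a countable type has a sequence that is
eventually in each member. -/
theorem exists_seq_eventually_mem {I : Type u} {α : Type} [Countable α] [Infinite α]
    (hI : #I < Cardinal.lift.{u} pseudoIntersectionNumber) (L : Finset I → Set α)
    (hanti : Antitone L) (hinf : ∀ F, (L F).Infinite) :
    ∃ a : ℕ → α, ∀ F, ∀ᶠ n in Filter.atTop, a n ∈ L F := by
  obtain ⟨e⟩ : Nonempty (α ≃ ℕ) := nonempty_equiv_of_countable
  have hfinset : #(Finset I) < Cardinal.lift.{u} pseudoIntersectionNumber := by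
    cases finite_or_infinite I with
    | inl h =>
      refine (Cardinal.lt_aleph0_of_finite _).trans_le ?_
      rw [← Cardinal.lift_aleph0.{u, 0}]
      exact Cardinal.lift_le.2 aleph0_le_pseudoIntersectionNumber
    | inr h => rwa [Cardinal.mk_finset_of_infinite]
  have hcard : #(range fun F => e '' L F) < pseudoIntersectionNumber := by
    have := (Cardinal.mk_range_le_lift (f := fun F => e '' L F)).trans_lt
      ((Cardinal.lift_id'.{0, u} _).trans_lt hfinset)
    exact Cardinal.lift_lt.1 this
  classical
  have hsfip : HasSFIP (range fun F => e '' L F) := by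
    intro 𝓖 hG hfin
    choose! F hF using hG
    refine ((hinf (hfin.toFinset.sup F)).image e.injective.injOn).mono ?_
    rintro _ ⟨x, hx, rfl⟩ G hGm
    rw [← hF hGm]
    exact ⟨x, hanti (Finset.le_sup (hfin.mem_toFinset.2 hGm)) hx, rfl⟩
  obtain ⟨A, hA, hAF⟩ := exists_pseudoIntersection hsfip hcard
  refine ⟨fun n => e.symm (Nat.nth (· ∈ A) n), fun F => ?_⟩
  have hinj : Function.Injective (Nat.nth (· ∈ A)) := Nat.nth_injective hA
  have h := (hAF _ ⟨F, rfl⟩).preimage hinj.injOn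
  rw [← Nat.cofinite_eq_atTop]
  refine h.subset fun n hn => ⟨Nat.nth_mem_of_infinite hA n, ?_⟩
  rintro ⟨x, hx, hxn⟩
  refine hn ?_
  change e.symm _ ∈ L F
  rw [← hxn, e.symm_apply_apply]
  exact hx

/-- A type of cardinality at most the continuum carries countably many subsets inducing every
subset of every finite set. -/
theorem exists_countable_traces {I : Type u} (hI : #I ≤ Cardinal.continuum) :
    ∃ d : Finset (ℚ × ℚ) → Set I, ∀ (F : Finset I) (S : Set I), ∃ c, ∀ i ∈ F, i ∈ S ↔ i ∈ d c := by
  obtain ⟨e⟩ : Nonempty (I ↪ ℝ) := by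
    rw [← Cardinal.lift_mk_le', Cardinal.mk_real]
    simpa using hI
  -- View `I` inside `ℝ`: a code is a finite union of rational intervals, and each point of `F ∩ S`
  -- gets an interval missing the rest of `F`.
  refine ⟨fun c => {i | ∃ q ∈ c, (q.1 : ℝ) < e i ∧ e i < q.2}, fun F S => ?_⟩
  classical
  have h : ∀ i : I, ∃ q : ℚ × ℚ, ((q.1 : ℝ) < e i ∧ e i < q.2) ∧
      ∀ j ∈ F, ((q.1 : ℝ) < e j ∧ e j < q.2) → j = i := by
    intro i
    have hopen : IsOpen ((F.erase i).image e : Set ℝ)ᶜ :=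
      (Finset.finite_toSet _).isClosed.isOpen_compl
    have hi : e i ∈ ((F.erase i).image e : Set ℝ)ᶜ := by simp
    obtain ⟨ε, hε, hball⟩ := Metric.isOpen_iff.1 hopen _ hi
    obtain ⟨q, hq, hq'⟩ := exists_rat_btwn (sub_lt_self (e i) hε)
    obtain ⟨r, hr, hr'⟩ := exists_rat_btwn (lt_add_of_pos_right (e i) hε)
    refine ⟨(q, r), ⟨hq', hr⟩, fun j hj hjq => ?_⟩
    by_contra hne
    refine hball (a := e j) ?_ ?_
    · rw [Metric.mem_ball, Real.dist_eq, abs_lt]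
      constructor <;> linarith [hjq.1, hjq.2]
    · exact Finset.mem_coe.2 (Finset.mem_image_of_mem e (Finset.mem_erase.2 ⟨hne, hj⟩))
  choose q hq hq' using h
  refine ⟨(F.filter (· ∈ S)).image q, fun i hi => ⟨fun hiS => ?_, ?_⟩⟩
  · exact ⟨q i, Finset.mem_image_of_mem q (Finset.mem_filter.2 ⟨hi, hiS⟩), hq i⟩
  · rintro ⟨_, hr, hir⟩
    obtain ⟨j, hj, rfl⟩ := Finset.mem_image.1 hr
    rw [hq' j i hi hir]
    exact (Finset.mem_filter.1 hj).2

end Cardinals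

/-! ### Finite paths and loops along a relation. -/

section Paths

/-- `x` restricted to `[0, n]` is a path of length `n` from `a` to `b` along `r`. -/
def IsPath {X : Type u} (r : X → X → Prop) (a b : X) (n : ℕ) (x : ℕ → X) : Prop :=
  x 0 = a ∧ x n = b ∧ ∀ j < n, r (x j) (x (j + 1))

theorem IsPath.exists_append {X : Type u} {r : X → X → Prop} {a b c : X} {n m : ℕ} {x y : ℕ → X}
    (hx : IsPath r a b n x) (hy : IsPath r b c m y) :
    ∃ z, IsPath r a c (n + m) z ∧ (∀ j ≤ n, z j = x j) ∧ ∀ j, z (n + j) = y j := by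
  have hle : ∀ j ≤ n, (if j < n then x j else y (j - n)) = x j := by
    intro j hj
    split_ifs with h
    · rfl
    · rw [le_antisymm hj (not_lt.1 h), Nat.sub_self, hy.1, hx.2.1]
  have hge : ∀ j, (if n + j < n then x (n + j) else y (n + j - n)) = y j := by
    intro j
    rw [if_neg (by omega), Nat.add_sub_cancel_left]
  refine ⟨fun j => if j < n then x j else y (j - n),
    ⟨(hle 0 (Nat.zero_le n)).trans hx.1, (hge m).trans hy.2.1, fun j hj => ?_⟩, hle, hge⟩
  rcases lt_or_ge j n with h | h
  · change r (if j < n then x j else _) (if j + 1 < n then x (j + 1) else _)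
    rw [hle j h.le, hle (j + 1) h]
    exact hx.2.2 j h
  · obtain ⟨k, rfl⟩ := Nat.exists_eq_add_of_le h
    rw [show n + k + 1 = n + (k + 1) from rfl]
    simp only [hge]
    exact hy.2.2 k (by omega)

theorem exists_isPath_of_transGen {X : Type u} {r : X → X → Prop} {a b : X}
    (h : Relation.TransGen r a b) : ∃ n x, 0 < n ∧ IsPath r a b n x := by
  induction h with
  | @single b h =>
    refine ⟨1, fun j => if j = 0 then a else b, one_pos, rfl, rfl, fun j hj => ?_⟩
    obtain rfl : j = 0 := by omega
    exact h
  | @tail b c _ h ih =>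
    obtain ⟨n, x, hn, hx⟩ := ih
    have hy : IsPath r b c 1 (fun j => if j = 0 then b else c) := by
      refine ⟨rfl, rfl, fun j hj => ?_⟩
      obtain rfl : j = 0 := by omega
      exact h
    obtain ⟨z, hz, -⟩ := hx.exists_append hy
    exact ⟨n + 1, z, by omega, hz⟩

/-- Each new point is reached by appending a detour from `a` and back. The strict bound `j < n`
matters because a code of length `n` does not record the endpoint. -/
theorem exists_loop_visiting {X : Type u} {r : X → X → Prop}
    (hr : ∀ a b, Relation.TransGen r a b) (a : X) (S : Finset X) :
    ∃ n x, 0 < n ∧ IsPath r a a n x ∧ ∀ y ∈ S, ∃ j < n, x j = y := by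
  classical
  induction S using Finset.induction_on with
  | empty =>
    obtain ⟨n, x, hn, hx⟩ := exists_isPath_of_transGen (hr a a)
    exact ⟨n, x, hn, hx, by simp⟩
  | insert y S _ ih =>
    obtain ⟨n, x, hn, hx, hS⟩ := ih
    obtain ⟨k, u, hk, hu⟩ := exists_isPath_of_transGen (hr a y)
    obtain ⟨l, v, hl, hv⟩ := exists_isPath_of_transGen (hr y a)
    obtain ⟨w, hw, hwn, hwk⟩ := hx.exists_append hu
    obtain ⟨z, hz, hzw, -⟩ := hw.exists_append hv
    refine ⟨n + k + l, z, by omega, hz, fun t ht => ?_⟩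
    rcases Finset.mem_insert.1 ht with rfl | ht
    · exact ⟨n + k, by omega, by rw [hzw _ le_rfl, hwk, hu.2.1]⟩
    · obtain ⟨j, hj, rfl⟩ := hS t ht
      exact ⟨j, by omega, by rw [hzw j (by omega), hwn j hj.le]⟩

end Paths

/-! ### Positions in a concatenation of finite blocks. -/

section Concatenation

/-- Successor of a position `(i, j)`, the `j`-th entry of the `i`-th block, when block `i` has
length `len i`. -/
def nextPosition (len : ℕ → ℕ) (p : ℕ × ℕ) : ℕ × ℕ :=
  if p.2 + 1 < len p.1 then (p.1, p.2 + 1) else (p.1 + 1, 0)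

/-- The position of the `n`-th entry in the concatenation of blocks of lengths `len`. -/
def position (len : ℕ → ℕ) : ℕ → ℕ × ℕ
  | 0 => (0, 0)
  | n + 1 => nextPosition len (position len n)

variable {len : ℕ → ℕ}

theorem position_snd_lt (hlen : ∀ i, 0 < len i) (n : ℕ) :
    (position len n).2 < len (position len n).1 := by
  induction n with
  | zero => exact hlen 0
  | succ n ih =>
    rw [position, nextPosition]
    split_ifs with h
    · exact h
    · exact hlen _

theorem exists_position_eq (hlen : ∀ i, 0 < len i) (i : ℕ) :
    ∀ j < len i, ∃ n, i ≤ n ∧ position len n = (i, j) := by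
  have hmove : ∀ i n, position len n = (i, 0) → ∀ j < len i, position len (n + j) = (i, j) := by
    intro i n hn j
    induction j with
    | zero => exact fun _ => hn
    | succ j ih =>
      intro hj
      rw [← add_assoc, position, ih (by omega), nextPosition, if_pos hj]
  have hstart : ∃ n, i ≤ n ∧ position len n = (i, 0) := by
    induction i with
    | zero => exact ⟨0, le_rfl, rfl⟩
    | succ i ih =>
      obtain ⟨n, hin, hn⟩ := ih
      have hi := hlen i
      refine ⟨n + (len i - 1) + 1, by omega, ?_⟩
      rw [position, hmove i n hn _ (by omega), nextPosition, if_neg (by simp only; omega)]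
  obtain ⟨n, hin, hn⟩ := hstart
  exact fun j hj => ⟨n + j, by omega, hmove i n hn j hj⟩

theorem position_fst_mono : Monotone fun n => (position len n).1 := by
  refine monotone_nat_of_le_succ fun n => ?_
  rw [position, nextPosition]
  split_ifs <;> simp

theorem tendsto_position_fst (hlen : ∀ i, 0 < len i) :
    Filter.Tendsto (fun n => (position len n).1) Filter.atTop Filter.atTop := by
  refine Filter.tendsto_atTop_atTop_of_monotone position_fst_mono fun i => ?_
  obtain ⟨n, -, hn⟩ := exists_position_eq hlen i 0 (hlen i)
  exact ⟨n, by rw [hn]⟩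

end Concatenation

/-! ### Coding approximate orbits by subsets of `ℕ`. -/

section Codes

variable {X : Type u} [TopologicalSpace X] {I : Type v}

/-- `y` is an approximate image of `x` as far as the finitely many open sets `b i`, `i ∈ F`, can
tell. -/
def ChainStep (f : X → X) (b : I → Set X) (F : Finset I) (x y : X) : Prop :=
  ∀ i ∈ F, ∀ j ∈ F, f '' closure (b i) ⊆ b j → x ∈ closure (b i) → y ∈ b j

theorem ChainStep.mono {f : X → X} {b : I → Set X} {F G : Finset I} (h : F ⊆ G) {x y : X}
    (hxy : ChainStep f b G x y) : ChainStep f b F x y :=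
  fun i hi j hj => hxy i (h hi) j (h hj)

/-- The set of points reachable from `x` is open, and `f` maps its closure into it, so it is all of
`X`. -/
theorem WeaklyIncompressible.transGen_chainStep {f : X → X} (hw : WeaklyIncompressible f)
    {b : I → Set X} (hb : ∀ i, IsOpen (b i)) (F : Finset I) (x y : X) :
    Relation.TransGen (ChainStep f b F) x y := by
  classical
  have hself : ∀ z, ChainStep f b F z (f z) := fun z i _ j _ hij hz => hij ⟨z, hz, rfl⟩
  have hopen : ∀ z, IsOpen {w | ChainStep f b F z w} := by
    intro z
    simp only [ChainStep, ofPred_forall]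
    exact isOpen_biInter_finset fun i _ => isOpen_biInter_finset fun j _ =>
      isOpen_iInter_of_finite fun _ => isOpen_iInter_of_finite fun _ => hb j
  by_contra hxy
  refine hw {w | Relation.TransGen (ChainStep f b F) x w} ?_ ⟨f x, .single (hself x)⟩
    (fun h => hxy (h.ge (mem_univ y))) ?_
  · refine isOpen_iff_mem_nhds.2 fun w hw => ?_
    obtain ⟨z, hz, hzw⟩ : ∃ z, Relation.ReflTransGen (ChainStep f b F) x z ∧ ChainStep f b F z w :=
      Relation.TransGen.tail'_iff.1 hw
    exact Filter.mem_of_superset ((hopen z).mem_nhds hzw) fun v hv => .tail' hz hv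
  · rintro _ ⟨z, hz, rfl⟩
    -- A reachable `w` in this neighbourhood lies in no `closure (b i)`, `i ∈ F`, that omits `z`;
    -- hence `w` to `f z` is also a legal step.
    have hN : IsOpen (⋂ i ∈ F.filter fun i => z ∉ closure (b i), (closure (b i))ᶜ) :=
      isOpen_biInter_finset fun i _ => isClosed_closure.isOpen_compl
    obtain ⟨w, hwN, hw⟩ := mem_closure_iff.1 hz _ hN (mem_iInter₂.2 fun i hi =>
      (Finset.mem_filter.1 hi).2)
    refine .tail hw fun i hi j _ hij hwi => hij ⟨z, ?_, rfl⟩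
    by_contra hzi
    exact mem_iInter₂.1 hwN i (Finset.mem_filter.2 ⟨hi, hzi⟩) hwi

/-- `A i` plays the role of `{n | x n ∈ b i}` for a virtual asymptotic pseudo-orbit `x` of `f` with
dense tails: each finite set of indices is matched, eventually, by a sequence in `X`. -/
structure IsPseudoOrbitCode (f : X → X) (b : I → Set X) (A : I → Set ℕ) : Prop where
  exists_seq : ∀ F : Finset I, ∃ x : ℕ → X, ∀ᶠ n in Filter.atTop,
    (∀ i ∈ F, x n ∈ b i ↔ n ∈ A i) ∧ ChainStep f b F (x n) (x (n + 1))
  infinite : ∀ i, (b i).Nonempty → (A i).Infinite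

/-- The list `l` of codes describes, on the index set `F`, a loop at `a` of approximate steps of `f`
that meets each nonempty `b i`. -/
def IsLoopCode {ι : Type} (d : ι → Set I) (f : X → X) (b : I → Set X) (a : X) (F : Finset I)
    (l : List ι) : Prop :=
  ∃ x : ℕ → X, 0 < l.length ∧ IsPath (ChainStep f b F) a a l.length x ∧
    (∀ (j : ℕ) (hj : j < l.length), ∀ i ∈ F, x j ∈ b i ↔ i ∈ d l[j]) ∧
    ∀ i ∈ F, (b i).Nonempty → ∃ j < l.length, x j ∈ b i

theorem exists_isLoopCode {ι : Type} {d : ι → Set I}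
    (hd : ∀ (F : Finset I) (S : Set I), ∃ c, ∀ i ∈ F, i ∈ S ↔ i ∈ d c) {f : X → X}
    (hw : WeaklyIncompressible f) {b : I → Set X} (hb : ∀ i, IsOpen (b i)) (a : X)
    (F : Finset I) : ∃ l, IsLoopCode d f b a F l := by
  classical
  have : ∀ i, ∃ y, (b i).Nonempty → y ∈ b i := fun i => by
    by_cases h : (b i).Nonempty
    · exact ⟨h.some, fun _ => h.some_mem⟩
    · exact ⟨a, fun h' => absurd h' h⟩
  choose y hy using this
  obtain ⟨n, x, hn, hx, hS⟩ := exists_loop_visiting (hw.transGen_chainStep hb F) a (F.image y)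
  choose c hc using fun j => hd F {i | x j ∈ b i}
  refine ⟨(List.range n).map c, x, by simpa using hn, by simpa using hx, fun j hj i hi => ?_,
    fun i hi hne => ?_⟩
  · simpa using hc j i hi
  · obtain ⟨j, hj, hjy⟩ := hS _ (Finset.mem_image_of_mem y hi)
    exact ⟨j, by simpa using hj, hjy ▸ hy i hne⟩

theorem exists_isPseudoOrbitCode {I : Type u} [Nonempty X] {f : X → X}
    (hw : WeaklyIncompressible f) {b : I → Set X} (hb : ∀ i, IsOpen (b i))
    (hI : #I < Cardinal.lift.{u} pseudoIntersectionNumber) :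
    ∃ A : I → Set ℕ, IsPseudoOrbitCode f b A := by
  obtain ⟨a⟩ := ‹Nonempty X›
  have hIc : #I ≤ Cardinal.continuum := by
    refine hI.le.trans ?_
    rw [← Cardinal.lift_continuum.{u, 0}]
    exact Cardinal.lift_le.2 pseudoIntersectionNumber_le_continuum
  obtain ⟨d, hd⟩ := exists_countable_traces hIc
  obtain ⟨s, hs⟩ := exists_seq_eventually_mem hI
    -- The dummy `ℕ` coordinate makes each set of codes infinite.
    (fun F => {p : ℕ × List (Finset (ℚ × ℚ)) | IsLoopCode d f b a F p.2})
    (fun F G hFG p ⟨x, hx, hp, ht, hv⟩ => ⟨x, hx,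
      ⟨hp.1, hp.2.1, fun j hj => (hp.2.2 j hj).mono hFG⟩,
      fun j hj i hi => ht j hj i (hFG hi), fun i hi => hv i (hFG hi)⟩)
    (fun F => by
      obtain ⟨l, hl⟩ := exists_isLoopCode hd hw hb a F
      refine (infinite_range_of_injective
        (f := fun k : ℕ => ((k, l) : ℕ × List (Finset (ℚ × ℚ)))) fun k m h =>
          (Prod.ext_iff.1 h).1).mono ?_
      rintro _ ⟨k, rfl⟩
      exact hl)
  -- Blocks are padded to be nonempty, so that positions make sense from the start.
  let l : ℕ → List (Finset (ℚ × ℚ)) := fun n => if (s n).2 = [] then [∅] else (s n).2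
  let len : ℕ → ℕ := fun n => (l n).length
  have hlen : ∀ n, 0 < len n := fun n => by
    simp only [len, l]
    split_ifs with h
    · simp
    · exact List.length_pos_iff.2 h
  have hloop : ∀ F, ∃ N, ∀ n ≥ N, IsLoopCode d f b a F (l n) := fun F => by
    obtain ⟨N, hN⟩ := Filter.eventually_atTop.1 (hs F)
    refine ⟨N, fun n hn => ?_⟩
    have h : IsLoopCode d f b a F (s n).2 := hN n hn
    have hne : (s n).2 ≠ [] := List.length_pos_iff.1 h.choose_spec.1
    simpa only [l, if_neg hne] using h
  have hpos := position_snd_lt hlen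
  refine ⟨fun i => {n | i ∈ d ((l (position len n).1)[(position len n).2]'(hpos n))},
    fun F => ?_, fun i hne => ?_⟩
  · obtain ⟨N, hN⟩ := hloop F
    choose! x hx0 hx hxt hxv using hN
    refine ⟨fun n => x (position len n).1 (position len n).2, ?_⟩
    filter_upwards [(tendsto_position_fst hlen).eventually_ge_atTop N] with n hn
    refine ⟨fun i hi => hxt _ hn _ (hpos n) i hi, ?_⟩
    have hstep := (hx _ hn).2.2 _ (hpos n)
    -- Where one block ends the next starts at the same point, since all loops are based at `a`.
    have hnext : x (position len (n + 1)).1 (position len (n + 1)).2 =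
        x (position len n).1 ((position len n).2 + 1) := by
      rw [position, nextPosition]
      split_ifs with h
      · rfl
      · have heq : (position len n).2 + 1 = (l (position len n).1).length :=
          le_antisymm (hpos n) (not_lt.1 h)
        rw [heq, (hx _ hn).2.1]
        exact (hx _ (by simp only; omega)).1
    rw [hnext]
    exact hstep
  · obtain ⟨N, hN⟩ := hloop {i}
    refine infinite_of_not_bddAbove fun ⟨M, hM⟩ => ?_
    -- Every position in this block exceeds the supposed bound `M`.
    obtain ⟨x, -, -, hxt, hxv⟩ := hN (N + M + 1) (by omega)
    obtain ⟨j, hj, hji⟩ := hxv i (Finset.mem_singleton_self i) hne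
    obtain ⟨n, hn, hnj⟩ := exists_position_eq hlen _ j hj
    have hmem : i ∈ d ((l (position len n).1)[(position len n).2]'(hpos n)) := by
      have := (hxt j hj i (Finset.mem_singleton_self i)).1 hji
      simpa only [hnj] using this
    have := hM hmem
    omega

end Codes

/-! ### From a pseudo-orbit code to the quotient map. -/

section Limit

variable {X : Type u} [TopologicalSpace X] {I : Type v} {f : X → X} {b : I → Set X}
  {A : I → Set ℕ}

/-- The transfer principle: finitely many conditions on membership in `p` are witnessed by actual
points of `X`. -/
theorem IsPseudoOrbitCode.exists_point (hA : IsPseudoOrbitCode f b A) (p : OmegaStar)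
    (F : Finset I) {S : Set ℕ} (hS : S ∈ p.1) :
    ∃ n ∈ S, ∃ x y, (∀ i ∈ F, x ∈ b i ↔ n ∈ A i) ∧ (∀ i ∈ F, y ∈ b i ↔ n + 1 ∈ A i) ∧
      ChainStep f b F x y := by
  obtain ⟨x, hx⟩ := hA.exists_seq F
  have h := hx.and ((Filter.tendsto_add_atTop_nat 1).eventually hx)
  obtain ⟨n, hn, hnx⟩ := p.1.nonempty_of_mem (Filter.inter_mem hS (p.mem_of_eventually h))
  exact ⟨n, hn, x n, x (n + 1), hnx.1.1, hnx.2.1, hnx.1.2⟩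

/-- The points of `X` adherent to every `b i` with `A i ∈ p`. -/
def limitSet (b : I → Set X) (A : I → Set ℕ) (p : OmegaStar) : Set X :=
  ⋂ i : {i // A i ∈ p.1}, closure (b i)

variable [CompactSpace X]

theorem IsPseudoOrbitCode.limitSet_nonempty (hA : IsPseudoOrbitCode f b A)
    (p : OmegaStar) : (limitSet b A p).Nonempty := by
  classical
  refine CompactSpace.iInter_nonempty (fun _ => isClosed_closure) fun T => ?_
  have hS : (⋂ i ∈ T, A i.1) ∈ p.1 := (Filter.biInter_finset_mem T).2 fun i _ => i.2
  obtain ⟨n, hn, x, -, hx, -⟩ := hA.exists_point p (T.image Subtype.val) hS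
  refine ⟨x, mem_iInter₂.2 fun i hi => subset_closure ?_⟩
  exact (hx i (Finset.mem_image_of_mem _ hi)).2 (mem_iInter₂.1 hn i hi)

theorem exists_finset_of_limitSet_subset {p : OmegaStar} {U : Set X} (hU : IsOpen U)
    (h : limitSet b A p ⊆ U) :
    ∃ T : Finset {i // A i ∈ p.1}, ⋂ i ∈ T, closure (b i.1) ⊆ U := by
  obtain ⟨T, hT⟩ := hU.isClosed_compl.isCompact.elim_finite_subfamily_closed
    (fun i : {i // A i ∈ p.1} => closure (b i)) (fun _ => isClosed_closure)
    (by rw [inter_comm, ← disjoint_iff_inter_eq_empty]; exact disjoint_compl_right_iff_subset.2 h)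
  refine ⟨T, disjoint_compl_right_iff_subset.1 ?_⟩
  rw [disjoint_iff_inter_eq_empty, inter_comm, hT]

theorem IsPseudoOrbitCode.mem_of_limitSet_subset (hA : IsPseudoOrbitCode f b A) {p : OmegaStar}
    {i : I} (hi : IsOpen (b i)) (h : limitSet b A p ⊆ b i) : A i ∈ p.1 := by
  classical
  obtain ⟨T, hT⟩ := exists_finset_of_limitSet_subset hi h
  by_contra hno
  have hS : (⋂ j ∈ T, A j.1) ∈ p.1 := (Filter.biInter_finset_mem T).2 fun j _ => j.2
  obtain ⟨n, hn, x, -, hx, -⟩ := hA.exists_point p (insert i (T.image Subtype.val))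
    (Filter.inter_mem hS (Ultrafilter.compl_mem_iff_notMem.2 hno))
  refine hn.2 ((hx i (Finset.mem_insert_self _ _)).1 (hT (mem_iInter₂.2 fun j hj => ?_)))
  exact subset_closure ((hx j (Finset.mem_insert_of_mem (Finset.mem_image_of_mem _ hj))).2
    (mem_iInter₂.1 hn.1 j hj))

variable [T2Space X]

theorem exists_basis_closure_subset (hb : TopologicalSpace.IsTopologicalBasis (range b)) {U : Set X}
    (hU : IsOpen U) {x : X} (hx : x ∈ U) : ∃ i, x ∈ b i ∧ closure (b i) ⊆ U := by
  obtain ⟨_, ⟨i, rfl⟩, hi, hiU⟩ := hb.exists_closure_subset (hU.mem_nhds hx)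
  exact ⟨i, hi, hiU⟩

theorem IsPseudoOrbitCode.limitSet_subsingleton (hA : IsPseudoOrbitCode f b A)
    (hb : TopologicalSpace.IsTopologicalBasis (range b)) (p : OmegaStar) :
    (limitSet b A p).Subsingleton := by
  intro x hx y hy
  by_contra hxy
  -- Finitely many such `b i` cover `X`, so one of the corresponding `A i` lies in `p`, and its
  -- closure would have to contain both points.
  have h : ∀ z, ∃ i, z ∈ b i ∧ ¬ (x ∈ closure (b i) ∧ y ∈ closure (b i)) := by
    intro z
    by_cases hz : z = x
    · obtain ⟨i, hi, hiU⟩ := exists_basis_closure_subset hb isOpen_compl_singleton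
        (show z ∈ ({y}ᶜ : Set X) from fun h => hxy (hz.symm.trans h))
      exact ⟨i, hi, fun h => hiU h.2 rfl⟩
    · obtain ⟨i, hi, hiU⟩ := exists_basis_closure_subset hb isOpen_compl_singleton
        (show z ∈ ({x}ᶜ : Set X) from hz)
      exact ⟨i, hi, fun h => hiU h.1 rfl⟩
  choose i hi hi' using h
  obtain ⟨T, hT⟩ := CompactSpace.elim_nhds_subcover (fun z => b (i z)) fun z =>
    (hb.isOpen (mem_range_self _)).mem_nhds (hi z)
  classical
  have hmem : (⋃ z ∈ T, A (i z)) ∈ p.1 := by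
    by_contra hno
    obtain ⟨n, hn, w, -, hw, -⟩ := hA.exists_point p (T.image i)
      (Ultrafilter.compl_mem_iff_notMem.2 hno)
    obtain ⟨z, hz, hwz⟩ := mem_iUnion₂.1 (hT.ge (mem_univ w))
    exact hn (mem_iUnion₂.2 ⟨z, hz, (hw _ (Finset.mem_image_of_mem i hz)).1 hwz⟩)
  obtain ⟨z, hz, hzp⟩ := (Ultrafilter.finite_biUnion_mem_iff T.finite_toSet).1 hmem
  exact hi' z ⟨mem_iInter.1 hx ⟨i z, hzp⟩, mem_iInter.1 hy ⟨i z, hzp⟩⟩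

theorem IsPseudoOrbitCode.isQuotientSystem (hA : IsPseudoOrbitCode f b A) (hf : Continuous f)
    (hb : TopologicalSpace.IsTopologicalBasis (range b)) : IsQuotientSystem f shiftMap := by
  classical
  choose Q hQ using hA.limitSet_nonempty
  have huniq : ∀ p x, x ∈ limitSet b A p → x = Q p := fun p x hx =>
    hA.limitSet_subsingleton hb p hx (hQ p)
  have hopen : ∀ i, IsOpen (b i) := fun i => hb.isOpen (mem_range_self i)
  have hmem : ∀ p i, Q p ∈ b i → A i ∈ p.1 := fun p i hi =>
    hA.mem_of_limitSet_subset (hopen i) fun x hx => huniq p x hx ▸ hi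
  have hcont : Continuous Q := by
    refine continuous_iff_continuousAt.2 fun p => ?_
    refine fun U hU => ?_
    obtain ⟨V, hVU, hV, hpV⟩ := mem_nhds_iff.1 hU
    obtain ⟨T, hT⟩ := exists_finset_of_limitSet_subset (b := b) (A := A) (p := p) hV
      fun x hx => huniq p x hx ▸ hpV
    have hS : (⋂ j ∈ T, A j.1) ∈ p.1 := (Filter.biInter_finset_mem T).2 fun j _ => j.2
    refine Filter.mem_map.2 <| Filter.mem_of_superset ((OmegaStar.isOpen_basic _).mem_nhds hS) fun q hq => hVU (hT ?_)
    refine mem_iInter₂.2 fun j hj => mem_iInter.1 (hQ q) ⟨j.1, ?_⟩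
    exact (Filter.biInter_finset_mem T).1 hq j hj
  refine ⟨Q, hcont, ?_, ?_⟩
  · have hdense : DenseRange Q := by
      refine dense_iff_inter_open.2 fun U hU ⟨x, hx⟩ => ?_
      obtain ⟨i, hi, hiU⟩ := exists_basis_closure_subset hb hU hx
      obtain ⟨p, hp⟩ := OmegaStar.exists_mem_of_infinite (hA.infinite i ⟨x, hi⟩)
      exact ⟨Q p, hiU (mem_iInter.1 (hQ p) ⟨i, hp⟩), mem_range_self p⟩
    exact range_eq_univ.1
      ((isCompact_range hcont).isClosed.closure_eq.symm.trans hdense.closure_range)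
  · funext p
    -- If `f (Q p)` avoided `closure (b v)`, a `b w` around it would be disjoint from `b v`; a chain
    -- step out of a `b i` around `Q p` would land in both.
    refine (huniq _ _ (mem_iInter.2 fun ⟨v, hv⟩ => ?_)).symm
    by_contra hno
    obtain ⟨w, hw, hwv⟩ := exists_basis_closure_subset hb isClosed_closure.isOpen_compl
      (show f (Q p) ∈ (closure (b v))ᶜ from hno)
    obtain ⟨i, hi, hiw⟩ := exists_basis_closure_subset hb ((hopen w).preimage hf) hw
    have hv' : {n | n + 1 ∈ A v} ∈ p.1 := hv
    obtain ⟨n, hn, x, y, hx, hy, hxy⟩ := hA.exists_point p {i, w, v}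
      (Filter.inter_mem (hmem p i hi) hv')
    have hxi : x ∈ b i := (hx i (by simp)).2 hn.1
    have hyv : y ∈ b v := (hy v (by simp)).2 hn.2
    have hyw : y ∈ b w := hxy i (by simp) w (by simp) (image_subset_iff.2 hiw)
      (subset_closure hxi)
    exact hwv (subset_closure hyw) (subset_closure hyv)

end Limit

theorem mainTheorem2 {X : Type u} [TopologicalSpace X] [CompactSpace X] [T2Space X] [Nonempty X]
    (f : X → X) (hf : Continuous f)
    (hw : topologicalWeight X < Cardinal.lift.{u} pseudoIntersectionNumber) :
    IsQuotientSystem f shiftMap ↔ WeaklyIncompressible f := by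
  refine ⟨weaklyIncompressible_of_isQuotientSystem hf, fun h => ?_⟩
  obtain ⟨B, hB, hcard⟩ := csInf_mem (s := {κ | ∃ B : Set (Set X),
    TopologicalSpace.IsTopologicalBasis B ∧ #B = κ})
    ⟨_, _, TopologicalSpace.isTopologicalBasis_opens, rfl⟩
  obtain ⟨A, hA⟩ := exists_isPseudoOrbitCode h (b := ((↑) : B → Set X)) (fun i => hB.isOpen i.2)
    (hcard.trans_lt hw)
  exact hA.isQuotientSystem hf (by rwa [Subtype.range_coe])
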